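/- Let $\mu_4$ be the middle-fourth Cantor measure, i.e. the unique Borel probability measure on $\mathbb R$ with $\mu_4=\tfrac12\,\mu_4\circ\sigma_1^{-1}+\tfrac12\,\mu_4\circ\sigma_2^{-1}$, where $\sigma_1(x)=x/4$ and $\sigma_2(x)=(x+2)/4$. A discrete set $\Lambda\subset\mathbb R$ is called a spectrum for $\mu_4$ if the exponentials $e_\lambda(x)=e^{2\pi i\lambda x}$, $\lambda\in\Lambda$, form an orthonormal basis of $L^2(\mu_4)$. Let $A_1=a_1a_2a_3\cdots=\tau_1\tau_2\tau_3\cdots$ be the infinite word obtained by concatenating the finite words $\tau_n=1^n(-1)^{n+1}$ ($n$ letters $1$ followed by $n+1$ letters $-1$), $n\ge 1$, and let $$\Lambda(A_1)=\Big\{\sum_{k=1}^{n}4^{k-1}\omega_k:\ n\ge 1,\ \omega_k\in\{0,a_k\}\text{ for }1\le k\le n\Big\}.$$ Then $\Lambda(A_1)$ is a spectrum for $\mu_4$, and for every odd integer $p$ the scaled set $p\Lambda(A_1)=\{p\lambda:\lambda\in\Lambda(A_1)\}$ is a spectrum for $\mu_4$. -/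

import Mathlib

open MeasureTheory
open scoped ENNReal Pointwise

/-- The law of one fair coin flip. -/
noncomputable def fairCoin : Measure Bool := (PMF.uniformOfFintype Bool).toMeasure

/-- The point `∑_{k ≥ 1} 4^{-k} d_k` of the middle-fourth Cantor set, with digits `d_k ∈ {0, 2}`,
coded by a sequence of coin flips. -/
noncomputable def cantorPoint (w : ℕ → Bool) : ℝ :=
  ∑' k : ℕ, (if w k then 2 else 0) / 4 ^ (k + 1)

/-- The middle-fourth Cantor measure `μ₄`: the law of `∑_{k ≥ 1} 4^{-k} d_k` where the digits `d_k`
are independent and uniformly distributed on `{0, 2}`.  The lemma `cantorMeasure4_invariant` below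
shows that this is the self-similar probability measure of the maps `x / 4` and `(x + 2) / 4`. -/
noncomputable def cantorMeasure4 : Measure ℝ :=
  (Measure.infinitePi fun _ : ℕ => fairCoin).map cantorPoint

/-- The exponential function `e_l(x) = exp(2 π i l x)`. -/
noncomputable def expFun (l : ℝ) (x : ℝ) : ℂ :=
  Complex.exp (2 * Real.pi * Complex.I * l * x)

/-- A discrete set `S ⊆ ℝ` is a spectrum for `μ` if the exponentials `e_l`, `l ∈ S`, form an
orthonormal (Hilbert) basis of `L²(μ)`. -/
def IsSpectrum (μ : Measure ℝ) (S : Set ℝ) : Prop :=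
  DiscreteTopology S ∧
    ∃ b : HilbertBasis S ℂ (Lp ℂ 2 μ), ∀ l : S, (b l : ℝ → ℂ) =ᵐ[μ] expFun l

/-- The set `Λ(A)` of all finite sums `∑_{k=1}^n 4^{k-1} ω_k`, `n ≥ 1`, `ω_k ∈ {0, a_k}`, attached
to the label `A = a₁ a₂ a₃ ⋯` (the value of `a` at `0` plays no role). -/
def labelSet (a : ℕ → ℤ) : Set ℝ :=
  {x | ∃ n : ℕ, 1 ≤ n ∧ ∃ w : ℕ → ℤ, (∀ k, w k = 0 ∨ w k = a k) ∧
    x = ∑ k ∈ Finset.Icc 1 n, (4 : ℝ) ^ (k - 1) * (w k : ℝ)}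

/-- The letters `a₁ a₂ a₃ ⋯` of the infinite word `τ₁ τ₂ τ₃ ⋯`, `τ_n = 1^n (-1)^{n+1}`.  The block
`τ_n` has length `2 n + 1` and occupies the positions `n² ≤ k < (n + 1)²`, and its first `n` letters
are `1`; see `labelA1_prefix`. (The value at `0` plays no role.) -/
def labelA1 (k : ℕ) : ℤ :=
  if k < k.sqrt ^ 2 + k.sqrt then 1 else -1

/-- The word `τ_n = 1^n (-1)^{n+1}`. -/
def tauWord (n : ℕ) : List ℤ := List.replicate n 1 ++ List.replicate (n + 1) (-1)

/-- The first `(N + 1)² - 1` letters of `labelA1` are the word `τ₁ τ₂ ⋯ τ_N`. -/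
theorem labelA1_prefix (N : ℕ) :
    (List.range' 1 ((N + 1) ^ 2 - 1)).map labelA1 = (List.range' 1 N).flatMap tauWord := by
  induction N with
  | zero => simp
  | succ N ih =>
    have h1 : (N + 1 + 1) ^ 2 - 1 = ((N + 1) ^ 2 - 1) + ((N + 1) + (N + 2)) := by
      have : 1 ≤ (N + 1) ^ 2 := Nat.one_le_pow _ _ (by omega)
      have h2 : (N + 1 + 1) ^ 2 = (N + 1) ^ 2 + ((N + 1) + (N + 2)) := by ring
      omega
    have hp : 1 + ((N + 1) ^ 2 - 1) = (N + 1) ^ 2 := by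
      have : 1 ≤ (N + 1) ^ 2 := Nat.one_le_pow _ _ (by omega)
      omega
    rw [h1, ← List.range'_append_1, List.map_append, ih, List.range'_concat, List.flatMap_append,
      hp]
    congr 1
    have hs : ∀ i < 2 * N + 3, Nat.sqrt ((N + 1) ^ 2 + i) = N + 1 := by
      intro i hi
      rw [pow_two]
      exact Nat.sqrt_add_eq _ (by omega)
    rw [← List.range'_append_1, List.map_append]
    simp only [List.flatMap_singleton, tauWord, one_mul, Nat.add_comm 1 N]
    congr 1
    · rw [List.eq_replicate_iff]
      refine ⟨by simp, ?_⟩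
      intro b hb
      simp only [List.mem_map, List.mem_range'_1] at hb
      obtain ⟨k, ⟨hk1, hk2⟩, rfl⟩ := hb
      obtain ⟨i, rfl⟩ := Nat.exists_eq_add_of_le hk1
      rw [labelA1, hs i (by omega), if_pos (by omega)]
    · rw [List.eq_replicate_iff]
      refine ⟨by simp, ?_⟩
      intro b hb
      simp only [List.mem_map, List.mem_range'_1] at hb
      obtain ⟨k, ⟨hk1, hk2⟩, rfl⟩ := hb
      obtain ⟨i, rfl⟩ := Nat.exists_eq_add_of_le (show (N + 1) ^ 2 ≤ k by omega)
      rw [labelA1, hs i (by omega), if_neg (by omega)]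

instance : IsProbabilityMeasure fairCoin := by
  unfold fairCoin; infer_instance

theorem summable_cantorPoint (w : ℕ → Bool) :
    Summable fun k : ℕ => (if w k then (2 : ℝ) else 0) / 4 ^ (k + 1) := by
  refine Summable.of_nonneg_of_le (fun k => ?_) (fun k => ?_)
    ((summable_geometric_of_lt_one (r := (1 / 4 : ℝ)) (by norm_num) (by norm_num)).mul_left 2)
  · split_ifs <;> positivity
  · rw [one_div, inv_pow, ← div_eq_mul_inv]
    refine div_le_div₀ (by norm_num) (by split_ifs <;> norm_num) (by positivity) ?_
    exact pow_le_pow_right₀ (by norm_num) (by omega)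

theorem measurable_cantorPoint : Measurable cantorPoint := by
  refine measurable_of_tendsto_metrizable (f := fun n w =>
    ∑ k ∈ Finset.range n, (if w k then (2 : ℝ) else 0) / 4 ^ (k + 1)) (fun n => ?_) ?_
  · refine Finset.measurable_sum _ fun k _ => ?_
    exact (Measurable.of_discrete (f := fun b : Bool =>
      (if b then (2 : ℝ) else 0) / 4 ^ (k + 1))).comp (measurable_pi_apply k)
  · exact tendsto_pi_nhds.2 fun w => (summable_cantorPoint w).hasSum.tendsto_sum_nat

instance : IsProbabilityMeasure cantorMeasure4 :=
  Measure.isProbabilityMeasure_map measurable_cantorPoint.aemeasurable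

/-- Prepend one coin flip. -/
def consFlip (b : Bool) (w : ℕ → Bool) : ℕ → Bool
  | 0 => b
  | n + 1 => w n

theorem measurable_consFlip (b : Bool) : Measurable (consFlip b) := by
  refine measurable_pi_iff.2 fun n => ?_
  cases n with
  | zero => exact measurable_const
  | succ n => exact measurable_pi_apply n

theorem cantorPoint_consFlip (b : Bool) (w : ℕ → Bool) :
    cantorPoint (consFlip b w) = (cantorPoint w + if b then 2 else 0) / 4 := by
  rw [cantorPoint, (summable_cantorPoint _).tsum_eq_zero_add, cantorPoint, add_div, add_comm,
    ← tsum_div_const]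
  congr 1
  · refine tsum_congr fun k => ?_
    rw [div_div, ← pow_succ]; rfl
  · cases b <;> simp [consFlip]

theorem fairCoin_eq (t : Set Bool) :
    fairCoin t = (1 / 2 : ℝ≥0∞) * t.indicator 1 false + (1 / 2 : ℝ≥0∞) * t.indicator 1 true := by
  rw [fairCoin, PMF.toMeasure_apply_fintype]
  by_cases h0 : false ∈ t <;> by_cases h1 : true ∈ t <;>
    simp [h0, h1, PMF.uniformOfFintype_apply]

theorem infinitePi_fairCoin_eq :
    Measure.infinitePi (fun _ : ℕ => fairCoin) =
      (1 / 2 : ℝ≥0∞) • (Measure.infinitePi fun _ : ℕ => fairCoin).map (consFlip false) +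
      (1 / 2 : ℝ≥0∞) • (Measure.infinitePi fun _ : ℕ => fairCoin).map (consFlip true) := by
  symm
  refine Measure.eq_infinitePi _ fun s t ht => ?_
  obtain ⟨N, hN⟩ := s.exists_nat_subset_range
  let t' : ℕ → Set Bool := fun n => if n ∈ s then t n else Set.univ
  have hset : Set.pi (s : Set ℕ) t = Set.pi (Finset.range (N + 1) : Set ℕ) t' := by
    ext w
    simp only [Set.mem_pi, Finset.mem_coe, t']
    constructor
    · intro h n _
      split_ifs with hn
      · exact h n hn
      · trivial
    · intro h n hn
      have := h n (Finset.range_mono (Nat.le_succ N) (hN hn))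
      rwa [if_pos hn] at this
  have hprod : ∏ n ∈ s, fairCoin (t n) = ∏ n ∈ Finset.range (N + 1), fairCoin (t' n) := by
    rw [← Finset.prod_subset (hN.trans (Finset.range_mono (Nat.le_succ N)))]
    · exact Finset.prod_congr rfl fun n hn => by simp [t', hn]
    · intro n _ hn
      simp only [t', if_neg hn]
      exact measure_univ
  have hmeas : MeasurableSet (Set.pi (Finset.range (N + 1) : Set ℕ) t') :=
    MeasurableSet.pi (Finset.countable_toSet _) fun n _ => MeasurableSet.of_discrete
  have hpre : ∀ b, Measure.map (consFlip b) (Measure.infinitePi fun _ : ℕ => fairCoin)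
      (Set.pi (Finset.range (N + 1) : Set ℕ) t') =
      (t' 0).indicator 1 b * ∏ n ∈ Finset.range N, fairCoin (t' (n + 1)) := by
    intro b
    rw [Measure.map_apply (measurable_consFlip b) hmeas]
    by_cases hb : b ∈ t' 0
    · have : consFlip b ⁻¹' Set.pi (Finset.range (N + 1) : Set ℕ) t' =
          Set.pi (Finset.range N : Set ℕ) fun n => t' (n + 1) := by
        ext w
        simp only [Set.mem_preimage, Set.mem_pi, Finset.mem_coe, Finset.mem_range]
        constructor
        · intro h n hn
          exact h (n + 1) (by omega)
        · intro h n hn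
          cases n with
          | zero => exact hb
          | succ n => exact h n (by omega)
      rw [this, Measure.infinitePi_pi _ fun _ _ => MeasurableSet.of_discrete]
      simp [hb]
    · have : consFlip b ⁻¹' Set.pi (Finset.range (N + 1) : Set ℕ) t' = ∅ := by
        ext w
        simp only [Set.mem_preimage, Set.mem_pi, Finset.mem_coe, Finset.mem_range,
          Set.mem_empty_iff_false, iff_false]
        exact fun h => hb (h 0 (by omega))
      rw [this]
      simp [hb]
  rw [hset, hprod, Finset.prod_range_succ', Measure.add_apply, Measure.smul_apply,
    Measure.smul_apply, hpre, hpre, fairCoin_eq (t' 0), smul_eq_mul, smul_eq_mul]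
  ring

/-- The invariance equation of the middle-fourth Cantor measure. -/
theorem cantorMeasure4_invariant :
    cantorMeasure4 = (1 / 2 : ℝ≥0∞) • cantorMeasure4.map (fun x => x / 4) +
      (1 / 2 : ℝ≥0∞) • cantorMeasure4.map (fun x => (x + 2) / 4) := by
  have h0 : Measurable fun x : ℝ => x / 4 := by fun_prop
  have h2 : Measurable fun x : ℝ => (x + 2) / 4 := by fun_prop
  have e0 : (fun x : ℝ => x / 4) ∘ cantorPoint = cantorPoint ∘ consFlip false := by
    funext w; simp [cantorPoint_consFlip]
  have e2 : (fun x : ℝ => (x + 2) / 4) ∘ cantorPoint = cantorPoint ∘ consFlip true := by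
    funext w; simp [cantorPoint_consFlip]
  conv_lhs => rw [cantorMeasure4, infinitePi_fairCoin_eq]
  rw [Measure.map_add _ _ measurable_cantorPoint, Measure.map_smul, Measure.map_smul,
    Measure.map_map measurable_cantorPoint (measurable_consFlip _),
    Measure.map_map measurable_cantorPoint (measurable_consFlip _), cantorMeasure4,
    Measure.map_map h0 measurable_cantorPoint, Measure.map_map h2 measurable_cantorPoint, e0, e2]

/-! The function `cantorPower` = |μ̂₄|² is the infinite product of cos²(πt/(2·4^k)), and its zeros
are the integers 4^j u with u odd. Distinct finite sums of terms 4^k b_k with all b_k odd differ by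
such a zero, so odd digits always give orthonormality. Exponentials of all real frequencies are
total in L²(μ₄), so completeness reduces to Parseval: the sum of `cantorPower (ξ + λ)` over the
frequencies λ is 1 for every ξ.

The partial products satisfy this identity exactly (`sum_cosProd_digitSum`), and only loss of mass
in the limit must be excluded. Let p > 0 and let n be a place where a long run of digits p meets a
long run of digits -p. For S below n, the run of p puts x = (ξ + λ_S)/4^n close to [0, p/3].
Extending S by digits -p at the places in T + n keeps the first n factors and leaves `cantorPower (x
- p * fourSum T)`. If some T makes this at least c, then the mass at S is at most 1/c times a term
of a convergent series, and the S not contained in a fixed range contribute little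
(`exists_one_le_sum_cantorPower`).

The constant c comes from arithmetic (`exists_not_cantorZero`) and compactness
(`exists_cantorPower_ge`). For negative p the two letters exchange roles, and the word has long runs
in both orders. -/

/-! ### The Fourier transform of μ₄, its product formula and its zeros -/

theorem expFun_eq_exp_mul_I (l x : ℝ) :
    expFun l x = Complex.exp ((2 * Real.pi * l * x : ℝ) * Complex.I) := by
  unfold expFun
  congr 1
  push_cast
  ring

theorem norm_expFun (l x : ℝ) : ‖expFun l x‖ = 1 := by
  rw [expFun_eq_exp_mul_I, Complex.norm_exp_ofReal_mul_I]

theorem continuous_expFun (l : ℝ) : Continuous (expFun l) := by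
  unfold expFun
  fun_prop

theorem conj_expFun_mul_expFun (l m x : ℝ) :
    (starRingEnd ℂ) (expFun l x) * expFun m x = expFun (m - l) x := by
  simp only [expFun_eq_exp_mul_I, ← Complex.exp_conj, map_mul, Complex.conj_ofReal,
    Complex.conj_I, ← Complex.exp_add]
  congr 1
  push_cast
  ring

theorem integrable_expFun (μ : Measure ℝ) [IsFiniteMeasure μ] (l : ℝ) :
    Integrable (expFun l) μ :=
  Integrable.of_bound (continuous_expFun l).aestronglyMeasurable 1
    (Filter.Eventually.of_forall fun x => (norm_expFun l x).le)

theorem memLp_expFun (μ : Measure ℝ) [IsFiniteMeasure μ] (l : ℝ) (q : ℝ≥0∞) :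
    MemLp (expFun l) q μ :=
  MemLp.of_bound (continuous_expFun l).aestronglyMeasurable 1
    (Filter.Eventually.of_forall fun x => (norm_expFun l x).le)

/-- The Fourier transform of the middle-fourth Cantor measure. -/
noncomputable def cantorFourier (t : ℝ) : ℂ := ∫ x, expFun t x ∂cantorMeasure4

theorem cantorFourier_zero : cantorFourier 0 = 1 := by
  simp [cantorFourier, expFun]

theorem continuous_cantorFourier : Continuous cantorFourier := by
  refine continuous_of_dominated (bound := fun _ => 1)
    (fun t => (continuous_expFun t).aestronglyMeasurable)
    (fun t => Filter.Eventually.of_forall fun x => (norm_expFun t x).le)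
    (integrable_const _) (Filter.Eventually.of_forall fun x => ?_)
  unfold expFun
  fun_prop

theorem cantorFourier_eq (t : ℝ) :
    cantorFourier t = (1 + Complex.exp (Real.pi * t * Complex.I)) / 2 * cantorFourier (t / 4) := by
  have h0 : Measurable fun x : ℝ => x / 4 := by fun_prop
  have h2 : Measurable fun x : ℝ => (x + 2) / 4 := by fun_prop
  have i0 : Integrable (expFun t) (cantorMeasure4.map fun x => x / 4) := by
    have := Measure.isProbabilityMeasure_map (μ := cantorMeasure4) h0.aemeasurable
    exact integrable_expFun _ t
  have i2 : Integrable (expFun t) (cantorMeasure4.map fun x => (x + 2) / 4) := by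
    have := Measure.isProbabilityMeasure_map (μ := cantorMeasure4) h2.aemeasurable
    exact integrable_expFun _ t
  have e0 : ∀ x, expFun t (x / 4) = expFun (t / 4) x := fun x => by
    unfold expFun
    congr 1
    push_cast
    ring
  have e2 : ∀ x, expFun t ((x + 2) / 4)
      = Complex.exp (Real.pi * t * Complex.I) * expFun (t / 4) x := fun x => by
    unfold expFun
    rw [← Complex.exp_add]
    congr 1
    push_cast
    ring
  have hhalf : (1 / 2 : ℝ≥0∞) ≠ ∞ := by simp
  conv_lhs => rw [cantorFourier, cantorMeasure4_invariant]
  rw [integral_add_measure (i0.smul_measure hhalf) (i2.smul_measure hhalf),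
    integral_smul_measure, integral_smul_measure,
    integral_map h0.aemeasurable (continuous_expFun t).aestronglyMeasurable,
    integral_map h2.aemeasurable (continuous_expFun t).aestronglyMeasurable]
  simp only [e2, integral_const_mul]
  simp only [e0]
  rw [← cantorFourier]
  simp only [one_div, ENNReal.toReal_inv, ENNReal.toReal_ofNat, Complex.real_smul,
    Complex.ofReal_inv, Complex.ofReal_ofNat]
  ring

/-- The squared modulus of the Fourier transform of the middle-fourth Cantor measure. -/
noncomputable def cantorPower (t : ℝ) : ℝ := ‖cantorFourier t‖ ^ 2

theorem cantorPower_nonneg (t : ℝ) : 0 ≤ cantorPower t := by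
  unfold cantorPower; positivity

theorem cantorPower_zero : cantorPower 0 = 1 := by
  simp [cantorPower, cantorFourier_zero]

theorem continuous_cantorPower : Continuous cantorPower :=
  continuous_cantorFourier.norm.pow 2

theorem cantorPower_eq (t : ℝ) :
    cantorPower t = Real.cos (Real.pi * t / 2) ^ 2 * cantorPower (t / 4) := by
  unfold cantorPower
  rw [cantorFourier_eq, norm_mul, mul_pow]
  congr 1
  -- With θ = πt, the mean of 1 and e^{iθ} is e^{iθ/2} cos(θ/2).
  have h : (1 + Complex.exp (Real.pi * t * Complex.I)) / 2
      = Complex.exp ((Real.pi * t / 2 : ℝ) * Complex.I) * Real.cos (Real.pi * t / 2) := by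
    rw [Complex.ofReal_cos, Complex.cos]
    have h1 : Complex.exp (Real.pi * t * Complex.I)
        = Complex.exp ((Real.pi * t / 2 : ℝ) * Complex.I)
          * Complex.exp ((Real.pi * t / 2 : ℝ) * Complex.I) := by
      rw [← Complex.exp_add]
      congr 1
      push_cast
      ring
    have h2 : Complex.exp ((Real.pi * t / 2 : ℝ) * Complex.I)
        * Complex.exp (-(Real.pi * t / 2 : ℝ) * Complex.I) = 1 := by
      rw [← Complex.exp_add]
      simp
    rw [h1]
    linear_combination (-1 / 2 : ℂ) * h2
  rw [h, norm_mul, Complex.norm_exp_ofReal_mul_I, one_mul, Complex.norm_real, Real.norm_eq_abs,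
    sq_abs]

/-- The squared modulus of the Fourier transform of the `n`-th discrete approximation of the
middle-fourth Cantor measure. -/
noncomputable def cosProd (n : ℕ) (t : ℝ) : ℝ :=
  ∏ k ∈ Finset.range n, Real.cos (Real.pi * (t / 4 ^ k) / 2) ^ 2

theorem cosProd_nonneg (n : ℕ) (t : ℝ) : 0 ≤ cosProd n t :=
  Finset.prod_nonneg fun _ _ => sq_nonneg _

theorem cantorPower_eq_cosProd_mul (n : ℕ) (t : ℝ) :
    cantorPower t = cosProd n t * cantorPower (t / 4 ^ n) := by
  induction n with
  | zero => simp [cosProd]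
  | succ n ih =>
    rw [ih, cantorPower_eq (t / 4 ^ n), cosProd, cosProd, Finset.prod_range_succ, div_div,
      ← pow_succ, mul_assoc]

theorem tendsto_div_four_pow (t : ℝ) :
    Filter.Tendsto (fun n : ℕ => t / 4 ^ n) Filter.atTop (nhds 0) :=
  tendsto_const_nhds.div_atTop (tendsto_pow_atTop_atTop_of_one_lt (by norm_num))

theorem tendsto_cantorPower_div (t : ℝ) :
    Filter.Tendsto (fun n : ℕ => cantorPower (t / 4 ^ n)) Filter.atTop (nhds 1) := by
  rw [← cantorPower_zero]
  exact (continuous_cantorPower.tendsto 0).comp (tendsto_div_four_pow t)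

theorem tendsto_cosProd (t : ℝ) :
    Filter.Tendsto (fun n => cosProd n t) Filter.atTop (nhds (cantorPower t)) := by
  have h := (tendsto_const_nhds (x := cantorPower t)).div (tendsto_cantorPower_div t) one_ne_zero
  rw [div_one] at h
  refine h.congr' ?_
  filter_upwards [(tendsto_cantorPower_div t).eventually_ne one_ne_zero] with n hn
  rw [Pi.div_apply, cantorPower_eq_cosProd_mul n t, mul_div_cancel_right₀ _ hn]

/-- The integers `4 ^ j * u` with `u` odd: the zeros of the Fourier transform of the middle-fourth
Cantor measure. -/
def CantorZero (z : ℤ) : Prop := ∃ j : ℕ, ∃ u : ℤ, Odd u ∧ z = 4 ^ j * u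

theorem cantorPower_eq_zero_iff (t : ℝ) :
    cantorPower t = 0 ↔ ∃ z : ℤ, CantorZero z ∧ t = z := by
  constructor
  · intro h
    -- A late tail of the product is nonzero, so the zero comes from one of finitely many cosines.
    obtain ⟨n, hn⟩ := ((tendsto_cantorPower_div t).eventually_ne one_ne_zero).exists
    rw [cantorPower_eq_cosProd_mul n, mul_eq_zero, or_iff_left hn, cosProd,
      Finset.prod_eq_zero_iff] at h
    obtain ⟨k, -, hk⟩ := h
    rw [sq_eq_zero_iff, Real.cos_eq_zero_iff] at hk
    obtain ⟨j, hj⟩ := hk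
    refine ⟨4 ^ k * (2 * j + 1), ⟨k, 2 * j + 1, ⟨j, rfl⟩, rfl⟩, ?_⟩
    have h4 : (4 : ℝ) ^ k ≠ 0 := by positivity
    have hpi := Real.pi_ne_zero
    field_simp at hj
    push_cast
    linarith
  · rintro ⟨z, ⟨j, u, ⟨i, rfl⟩, rfl⟩, rfl⟩
    rw [cantorPower_eq_cosProd_mul (j + 1), mul_eq_zero]
    left
    rw [cosProd, Finset.prod_eq_zero_iff]
    refine ⟨j, by simp, ?_⟩
    rw [sq_eq_zero_iff, Real.cos_eq_zero_iff]
    refine ⟨i, ?_⟩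
    push_cast
    field_simp

/-! ### Finite Parseval identity and differences of digit sums -/

theorem cosProd_add_four_pow_mul (n : ℕ) (t : ℝ) (j : ℤ) :
    cosProd n (t + 4 ^ n * j) = cosProd n t := by
  refine Finset.prod_congr rfl fun k hk => ?_
  obtain ⟨d, rfl⟩ := Nat.exists_eq_add_of_lt (Finset.mem_range.1 hk)
  have h : Real.pi * ((t + 4 ^ (k + d + 1) * j) / 4 ^ k) / 2
      = Real.pi * (t / 4 ^ k) / 2 + (4 ^ d * j : ℤ) * (2 * Real.pi) := by
    push_cast
    have h4 : (4 : ℝ) ^ k ≠ 0 := by positivity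
    field_simp
    ring
  rw [h, Real.cos_add_int_mul_two_pi]

theorem cos_sq_add_cos_sq_of_odd (x : ℝ) {u : ℤ} (hu : Odd u) :
    Real.cos (Real.pi * x / 2) ^ 2 + Real.cos (Real.pi * (x + u) / 2) ^ 2 = 1 := by
  obtain ⟨i, rfl⟩ := hu
  have h : Real.pi * (x + (2 * i + 1 : ℤ)) / 2
      = (Real.pi * x / 2 + Real.pi / 2) + i * Real.pi := by
    push_cast
    ring
  rw [h, Real.cos_add_int_mul_pi, mul_pow, Real.cos_add_pi_div_two, neg_sq]
  have h1 : ((-1 : ℝ) ^ i) ^ 2 = 1 := by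
    rcases Int.even_or_odd i with h | h <;> simp [h.neg_one_zpow]
  rw [h1, one_mul, Real.cos_sq_add_sin_sq]

/-- The sum `∑_{k ∈ S} 4 ^ k b_k`. -/
def digitSum (b : ℕ → ℤ) (S : Finset ℕ) : ℤ := ∑ k ∈ S, 4 ^ k * b k

/-- A new digit leaves the earlier factors unchanged by periodicity, and the two values of the new
factor are cos² and sin² of one angle. -/
theorem sum_cosProd_digitSum {b : ℕ → ℤ} (hb : ∀ k, Odd (b k)) (ξ : ℝ) (n : ℕ) :
    ∑ S ∈ (Finset.range n).powerset, cosProd n (ξ + digitSum b S) = 1 := by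
  induction n with
  | zero => simp [cosProd]
  | succ n ih =>
    rw [Finset.range_add_one, Finset.sum_powerset_insert Finset.notMem_range_self,
      ← Finset.sum_add_distrib, ← ih]
    refine Finset.sum_congr rfl fun S hS => ?_
    have hn : n ∉ S := fun h => by simpa using Finset.mem_powerset.1 hS h
    have hsum : ξ + (digitSum b (insert n S) : ℤ) = ξ + digitSum b S + 4 ^ n * (b n : ℤ) := by
      rw [digitSum, Finset.sum_insert hn, ← digitSum]
      push_cast
      ring
    have hsucc : ∀ t, cosProd (n + 1) t
        = cosProd n t * Real.cos (Real.pi * (t / 4 ^ n) / 2) ^ 2 := fun t => by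
      rw [cosProd, Finset.prod_range_succ, ← cosProd]
    rw [hsum, hsucc, hsucc, cosProd_add_four_pow_mul, ← mul_add,
      add_div _ (4 ^ n * (b n : ℝ)), mul_div_cancel_left₀ _ (by positivity : (4 : ℝ) ^ n ≠ 0),
      cos_sq_add_cos_sq_of_odd _ (hb n), mul_one]

theorem CantorZero.ne_zero {z : ℤ} (h : CantorZero z) : z ≠ 0 := by
  obtain ⟨j, u, hu, rfl⟩ := h
  have : u ≠ 0 := by rintro rfl; simp at hu
  positivity

theorem CantorZero.four_dvd {z : ℤ} (h : CantorZero z) (hz : Even z) : 4 ∣ z := by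
  obtain ⟨j, u, hu, rfl⟩ := h
  cases j with
  | zero => simp [← Int.not_odd_iff_even, hu] at hz
  | succ j => exact ⟨4 ^ j * u, by ring⟩

theorem CantorZero.of_four_mul {z : ℤ} (h : CantorZero (4 * z)) : CantorZero z := by
  obtain ⟨j, u, hu, hz⟩ := h
  cases j with
  | zero =>
    obtain ⟨i, rfl⟩ := hu
    omega
  | succ j => exact ⟨j, u, hu, by rw [pow_succ] at hz; linarith⟩

/-- The lowest place j where S and T differ carries an odd digit, and all higher places contribute
multiples of 4^(j+1). -/
theorem cantorZero_digitSum_sub {b : ℕ → ℤ} (hb : ∀ k, Odd (b k)) {S T : Finset ℕ} (h : S ≠ T) :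
    CantorZero (digitSum b S - digitSum b T) := by
  set c : ℕ → ℤ := fun k => (if k ∈ S then b k else 0) - (if k ∈ T then b k else 0) with hc
  obtain ⟨N, hN⟩ := (S ∪ T).exists_nat_subset_range
  have hsum : digitSum b S - digitSum b T = ∑ k ∈ Finset.range N, 4 ^ k * c k := by
    have key : ∀ U ⊆ S ∪ T, digitSum b U
        = ∑ k ∈ Finset.range N, 4 ^ k * (if k ∈ U then b k else 0) := fun U hU => by
      rw [digitSum, ← Finset.sum_subset (hU.trans hN)]
      · exact Finset.sum_congr rfl fun k hk => by rw [if_pos hk]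
      · intro k _ hk
        rw [if_neg hk, mul_zero]
    rw [key S Finset.subset_union_left, key T Finset.subset_union_right, ← Finset.sum_sub_distrib]
    exact Finset.sum_congr rfl fun k _ => by rw [hc, mul_sub]
  have hex : ∃ k, Odd (c k) := by
    obtain ⟨k, hk⟩ := not_forall.1 fun h' => h (Finset.ext h')
    refine ⟨k, ?_⟩
    by_cases h1 : k ∈ S <;> by_cases h2 : k ∈ T <;> simp_all
  have heven : ∀ k, ¬ Odd (c k) → c k = 0 := fun k hk => by
    by_cases h1 : k ∈ S <;> by_cases h2 : k ∈ T <;> simp_all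
  classical
  set j := Nat.find hex with hj
  have hjo : Odd (c j) := Nat.find_spec hex
  have hjN : j < N := by
    by_contra hlt
    have : c j = 0 := by
      have h0 : j ∉ S ∪ T := fun hm => hlt (Finset.mem_range.1 (hN hm))
      rw [Finset.mem_union, not_or] at h0
      simp [hc, h0]
    simp [this] at hjo
  obtain ⟨d, rfl⟩ := Nat.exists_eq_add_of_lt hjN
  refine ⟨j, c j + 4 * ∑ i ∈ Finset.range d, 4 ^ i * c (j + 1 + i), ?_, ?_⟩
  · exact hjo.add_even (by simp [show Even (4 : ℤ) by decide])
  · rw [hsum, show j + d + 1 = (j + 1) + d by ring, Finset.sum_range_add, Finset.sum_range_succ,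
      Finset.sum_eq_zero fun k hk => by
        rw [heven k (Nat.find_min hex (Finset.mem_range.1 hk)), mul_zero],
      zero_add, mul_add, Finset.mul_sum, Finset.mul_sum]
    congr 1
    exact Finset.sum_congr rfl fun i _ => by ring

/-! ### Avoiding the zeros: division by 4 with digits 0 and p -/

/-- The sum `∑_{k ∈ T} 4 ^ k`. -/
def fourSum (T : Finset ℕ) : ℤ := ∑ k ∈ T, 4 ^ k

/-- The set `T` moved to the right by `n`. -/
def shiftRight (n : ℕ) (T : Finset ℕ) : Finset ℕ := T.map (addRightEmbedding n)

theorem mem_shiftRight {n : ℕ} {T : Finset ℕ} {k : ℕ} :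
    k ∈ shiftRight n T ↔ ∃ i ∈ T, i + n = k := by
  simp [shiftRight]

theorem fourSum_shiftRight_one (T : Finset ℕ) : fourSum (shiftRight 1 T) = 4 * fourSum T := by
  rw [fourSum, shiftRight, Finset.sum_map, fourSum, Finset.mul_sum]
  exact Finset.sum_congr rfl fun k _ => by simp [pow_succ, mul_comm]

theorem fourSum_insert_zero_shiftRight_one (T : Finset ℕ) :
    fourSum (insert 0 (shiftRight 1 T)) = 1 + 4 * fourSum T := by
  rw [fourSum, Finset.sum_insert (by simp [mem_shiftRight]), ← fourSum, fourSum_shiftRight_one,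
    pow_zero]

/-- One step of the division algorithm in base `4` with digits `0` and `p`. -/
def digitStep (p z : ℤ) : ℤ := if Even z then z / 4 else (z - p) / 4

/-- Exactness of the division comes from T = ∅ or T = {0}; the property passes to the quotient by
prepending a digit 0 or 1 to T. -/
theorem cantorZero_digitStep {p : ℤ} (hp : Odd p) {z : ℤ}
    (h : ∀ T, CantorZero (z - p * fourSum T)) :
    (4 * digitStep p z = z ∨ 4 * digitStep p z = z - p) ∧
      ∀ T, CantorZero (digitStep p z - p * fourSum T) := by
  by_cases hz : Even z
  · have h4 : 4 * digitStep p z = z := by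
      rw [digitStep, if_pos hz]
      exact Int.mul_ediv_cancel' ((by simpa [fourSum] using h ∅ : CantorZero z).four_dvd hz)
    refine ⟨Or.inl h4, fun T => ?_⟩
    have := h (shiftRight 1 T)
    rw [fourSum_shiftRight_one] at this
    refine CantorZero.of_four_mul ?_
    convert this using 1
    linear_combination h4
  · have h4 : 4 * digitStep p z = z - p := by
      rw [digitStep, if_neg hz]
      exact Int.mul_ediv_cancel' ((by simpa [fourSum] using h {0} : CantorZero (z - p)).four_dvd
        ((Int.not_even_iff_odd.1 hz).sub_odd hp))
    refine ⟨Or.inr h4, fun T => ?_⟩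
    have := h (insert 0 (shiftRight 1 T))
    rw [fourSum_insert_zero_shiftRight_one] at this
    refine CantorZero.of_four_mul ?_
    convert this using 1
    linear_combination h4

/-- Otherwise the division steps iterate forever inside [-p/3, z]. They are injective along the
orbit, so a repeated value forces a return to z, yet all later terms are below z. -/
theorem exists_not_cantorZero {p z : ℤ} (hp : Odd p) (hz : 0 < z) (hzp : 3 * z ≤ p) :
    ∃ T, ¬ CantorZero (z - p * fourSum T) := by
  by_contra! hbad
  set f : ℕ → ℤ := fun k => (digitStep p)^[k] z with hf
  have hall : ∀ k, ∀ T, CantorZero (f k - p * fourSum T) := fun k => by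
    induction k with
    | zero => exact hbad
    | succ k ih =>
      simp only [hf, Function.iterate_succ_apply']
      exact (cantorZero_digitStep hp ih).2
  have hstep : ∀ k, 4 * f (k + 1) = f k ∨ 4 * f (k + 1) = f k - p := fun k => by
    simp only [hf, Function.iterate_succ_apply']
    exact (cantorZero_digitStep hp (hall k)).1
  have hbound : ∀ k, -p ≤ 3 * f k ∧ f k ≤ z := fun k => by
    induction k with
    | zero => exact ⟨by simp only [hf, Function.iterate_zero_apply]; omega, le_rfl⟩
    | succ k ih => have := hstep k; omega
  have hlt : ∀ k, f (k + 1) < z := fun k => by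
    have := hstep k
    have := hbound k
    omega
  -- Two values with the same successor are equal or differ by p, but the orbit lies in an interval
  -- of length at most 2p/3.
  have hback : ∀ i d, f i = f (i + d) → f 0 = f d := fun i d => by
    induction i with
    | zero => simp
    | succ i ih =>
      intro h
      apply ih
      have h1 := hstep i
      have h2 := hstep (i + d)
      rw [show i + d + 1 = i + 1 + d by ring, ← h] at h2
      have := hbound i
      have := hbound (i + d)
      omega
  obtain ⟨i, j, hij, hfij⟩ : ∃ i j, i < j ∧ f i = f j := by
    obtain ⟨i, -, j, -, hne, h⟩ := Set.infinite_univ.exists_ne_map_eq_of_mapsTo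
      (f := f) (t := Set.Icc (-p) z) (fun k _ => by have := hbound k; constructor <;> omega)
      (Set.finite_Icc _ _)
    rcases hne.lt_or_gt with hlt | hlt
    exacts [⟨i, j, hlt, h⟩, ⟨j, i, hlt, h.symm⟩]
  obtain ⟨d, rfl⟩ := Nat.exists_eq_add_of_lt hij
  exact (hlt d).ne (hback i (d + 1) hfij).symm

theorem exists_cantorPower_pos {p : ℤ} (hp : Odd p) {x : ℝ} (hx : 0 ≤ x) (hxp : x ≤ p / 3) :
    ∃ T, 0 < cantorPower (x - p * fourSum T) := by
  by_cases h0 : cantorPower x = 0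
  · obtain ⟨z, hz, rfl⟩ := (cantorPower_eq_zero_iff x).1 h0
    have hz0 : 0 < z := lt_of_le_of_ne (by exact_mod_cast hx) hz.ne_zero.symm
    have hzp : 3 * z ≤ p := by
      have : (3 * z : ℝ) ≤ p := by linarith
      exact_mod_cast this
    obtain ⟨T, hT⟩ := exists_not_cantorZero hp hz0 hzp
    refine ⟨T, (cantorPower_nonneg _).lt_of_ne' fun h => hT ?_⟩
    obtain ⟨y, hy, hyz⟩ := (cantorPower_eq_zero_iff _).1 h
    have : z - p * fourSum T = y := by exact_mod_cast hyz
    rwa [this]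
  · exact ⟨∅, by simpa [fourSum] using (cantorPower_nonneg x).lt_of_ne' h0⟩

/-- Compactness of [0, p/3] makes the positivity uniform; the margin ε later absorbs ξ/4^n and the
low negative digits. -/
theorem exists_cantorPower_ge {p : ℤ} (hp : Odd p) (hp0 : 0 < p) :
    ∃ (c ε : ℝ) (m : ℕ), 0 < c ∧ 0 < ε ∧ ∀ x : ℝ, -ε ≤ x → x ≤ p / 3 + ε →
      ∃ T ⊆ Finset.range m, c ≤ cantorPower (x - p * fourSum T) := by
  -- One parameter controls both the range of T and the lower bound, so the sets increase and a
  -- single one covers the interval.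
  let U : ℕ → Set ℝ := fun m =>
    ⋃ T ∈ (Finset.range m).powerset, {x | 1 / (m + 1 : ℝ) < cantorPower (x - p * fourSum T)}
  have hUo : ∀ m, IsOpen (U m) := fun m => isOpen_biUnion fun T _ =>
    isOpen_lt continuous_const (continuous_cantorPower.comp (by fun_prop))
  have hUm : Monotone U := fun m n hmn x hx => by
    simp only [U, Set.mem_iUnion, Set.mem_ofPred_eq, Finset.mem_powerset] at hx ⊢
    obtain ⟨T, hT, h⟩ := hx
    refine ⟨T, hT.trans (Finset.range_mono hmn), lt_of_le_of_lt ?_ h⟩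
    exact one_div_le_one_div_of_le (by positivity) (by gcongr)
  obtain ⟨m, hm⟩ := (isCompact_Icc (a := (0 : ℝ)) (b := p / 3)).elim_directed_cover U hUo
    (fun x hx => by
      obtain ⟨T, hT⟩ := exists_cantorPower_pos hp hx.1 hx.2
      obtain ⟨M, hM⟩ := T.exists_nat_subset_range
      obtain ⟨n, hn⟩ := exists_nat_one_div_lt hT
      simp only [U, Set.mem_iUnion, Set.mem_ofPred_eq, Finset.mem_powerset]
      refine ⟨max M n, T, hM.trans (Finset.range_mono (le_max_left _ _)), lt_of_le_of_lt ?_ hn⟩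
      exact one_div_le_one_div_of_le (by positivity) (by gcongr; exact le_max_right _ _))
    (directed_of_isDirected_le hUm)
  obtain ⟨ε, hε, hsub⟩ := isCompact_Icc.exists_cthickening_subset_open (hUo m) hm
  have hp3 : (0 : ℝ) ≤ p / 3 := by
    have : (0 : ℝ) ≤ p := by exact_mod_cast hp0.le
    positivity
  refine ⟨1 / (m + 1), ε, m, by positivity, hε, fun x h1 h2 => ?_⟩
  have hx : x ∈ U m := by
    refine hsub (Metric.mem_cthickening_of_dist_le x (max 0 (min x (p / 3))) ε _
      ⟨le_max_left _ _, max_le hp3 (min_le_right _ _)⟩ ?_)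
    rw [Real.dist_eq, abs_le]
    rcases max_cases 0 (min x (p / 3 : ℝ)) with h | h <;>
      rcases min_cases x (p / 3 : ℝ) with h' | h' <;> constructor <;> linarith
  simp only [U, Set.mem_iUnion, Set.mem_ofPred_eq, Finset.mem_powerset] at hx
  obtain ⟨T, hT, h⟩ := hx
  exact ⟨T, hT, h.le⟩

/-! ### Totality of the exponentials and a Parseval criterion -/

/-- The exponential `e_l` as an element of `L²(μ)`. -/
noncomputable def expLp (μ : Measure ℝ) [IsFiniteMeasure μ] (l : ℝ) : Lp ℂ 2 μ :=
  (memLp_expFun μ l 2).toLp (expFun l)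

theorem coeFn_expLp (μ : Measure ℝ) [IsFiniteMeasure μ] (l : ℝ) :
    (expLp μ l : ℝ → ℂ) =ᵐ[μ] expFun l :=
  (memLp_expFun μ l 2).coeFn_toLp

theorem inner_expLp (μ : Measure ℝ) [IsFiniteMeasure μ] (l : ℝ) (g : Lp ℂ 2 μ) :
    inner ℂ (expLp μ l) g = ∫ x, (starRingEnd ℂ) (expFun l x) * g x ∂μ := by
  rw [L2.inner_def]
  refine integral_congr_ae ?_
  filter_upwards [coeFn_expLp μ l] with x hx
  rw [hx, RCLike.inner_apply, mul_comm]

theorem inner_expLp_expLp (μ : Measure ℝ) [IsFiniteMeasure μ] (l m : ℝ) :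
    inner ℂ (expLp μ l) (expLp μ m) = ∫ x, expFun (m - l) x ∂μ := by
  rw [inner_expLp]
  refine integral_congr_ae ?_
  filter_upwards [coeFn_expLp μ m] with x hx
  rw [hx, conj_expFun_mul_expFun]

theorem conj_expFun (l x : ℝ) : (starRingEnd ℂ) (expFun l x) = expFun (-l) x := by
  simp only [expFun_eq_exp_mul_I, ← Complex.exp_conj, map_mul, Complex.conj_ofReal,
    Complex.conj_I]
  congr 1
  push_cast
  ring

/-- The positive and negative parts of u are densities of two finite measures with the same
characteristic function. -/
theorem ae_eq_zero_of_integral_mul_expFun {μ : Measure ℝ} [IsFiniteMeasure μ] {u : ℝ → ℝ}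
    (hu : Integrable u μ) (h : ∀ l, ∫ x, u x * expFun l x ∂μ = 0) : u =ᵐ[μ] 0 := by
  have hpos : Integrable (fun x => max (u x) 0) μ := hu.pos_part
  have hneg : Integrable (fun x => max (-u x) 0) μ := hu.neg_part
  have hfin : ∀ {v : ℝ → ℝ}, Integrable v μ →
      IsFiniteMeasure (μ.withDensity fun x => ENNReal.ofReal (v x)) := fun hv =>
    isFiniteMeasure_withDensity_ofReal hv.2
  have := hfin hpos
  have := hfin hneg
  have hchar : ∀ {v : ℝ → ℝ}, Integrable v μ → (∀ x, 0 ≤ v x) → ∀ t,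
      charFun (μ.withDensity fun x => ENNReal.ofReal (v x)) t
        = ∫ x, v x * expFun (t / (2 * Real.pi)) x ∂μ := fun {v} hv hv0 t => by
    rw [charFun_apply_real, integral_withDensity_eq_integral_toReal_smul₀
      hv.1.aemeasurable.ennreal_ofReal (Filter.Eventually.of_forall fun x => ENNReal.ofReal_lt_top)]
    refine integral_congr_ae (Filter.Eventually.of_forall fun x => ?_)
    simp only [ENNReal.toReal_ofReal (hv0 x), Complex.real_smul, expFun_eq_exp_mul_I]
    congr 3
    have := Real.pi_ne_zero
    push_cast
    field_simp
  have hmul : ∀ {v : ℝ → ℝ}, Integrable v μ → ∀ l,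
      Integrable (fun x => (v x : ℂ) * expFun l x) μ := fun hv l =>
    hv.ofReal.mul_bdd (c := 1) (continuous_expFun l).aestronglyMeasurable
      (Filter.Eventually.of_forall fun x => (norm_expFun l x).le)
  have heq : (μ.withDensity fun x => ENNReal.ofReal (max (u x) 0))
      = μ.withDensity fun x => ENNReal.ofReal (max (-u x) 0) := by
    refine Measure.ext_of_charFun (funext fun t => ?_)
    rw [hchar hpos (fun x => le_max_right _ _), hchar hneg (fun x => le_max_right _ _),
      ← sub_eq_zero, ← integral_sub (hmul hpos _) (hmul hneg _), ← h (t / (2 * Real.pi))]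
    refine integral_congr_ae (Filter.Eventually.of_forall fun x => ?_)
    simp only
    rw [← sub_mul, ← Complex.ofReal_sub]
    congr 2
    rcases max_cases (u x) 0 with h1 | h1 <;> rcases max_cases (-u x) 0 with h2 | h2 <;> linarith
  rw [withDensity_eq_iff_of_sigmaFinite hpos.1.aemeasurable.ennreal_ofReal
    hneg.1.aemeasurable.ennreal_ofReal] at heq
  filter_upwards [heq] with x hx
  rw [ENNReal.ofReal_eq_ofReal_iff (le_max_right _ _) (le_max_right _ _)] at hx
  rw [Pi.zero_apply]
  rcases max_cases (u x) 0 with h1 | h1 <;> rcases max_cases (-u x) 0 with h2 | h2 <;> linarith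

theorem eq_zero_of_inner_expLp {μ : Measure ℝ} [IsFiniteMeasure μ] {g : Lp ℂ 2 μ}
    (h : ∀ l, inner ℂ (expLp μ l) g = 0) : g = 0 := by
  have hg : Integrable g μ := (Lp.memLp g).integrable (by norm_num)
  have hmul : ∀ l, Integrable (fun x => g x * expFun l x) μ := fun l =>
    hg.mul_bdd (c := 1) (continuous_expFun l).aestronglyMeasurable
      (Filter.Eventually.of_forall fun x => (norm_expFun l x).le)
  have h1 : ∀ l, ∫ x, g x * expFun l x ∂μ = 0 := fun l => by
    rw [← h (-l), inner_expLp]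
    refine integral_congr_ae (Filter.Eventually.of_forall fun x => ?_)
    simp only [conj_expFun, neg_neg, mul_comm]
  have h2 : ∀ l, ∫ x, (starRingEnd ℂ) (g x) * expFun l x ∂μ = 0 := fun l => by
    rw [← map_zero (starRingEnd ℂ), ← h1 (-l), ← integral_conj]
    refine integral_congr_ae (Filter.Eventually.of_forall fun x => ?_)
    simp only [map_mul, conj_expFun, neg_neg]
  have hmul2 : ∀ l, Integrable (fun x => (starRingEnd ℂ) (g x) * expFun l x) μ := fun l => by
    refine (Complex.conjLIE.integrable_comp_iff.2 (hmul (-l))).congr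
      (Filter.Eventually.of_forall fun x => ?_)
    simp [conj_expFun]
  have hre : (fun x => (g x).re) =ᵐ[μ] 0 := by
    refine ae_eq_zero_of_integral_mul_expFun hg.re fun l => ?_
    have h3 : ∀ x, ((g x).re : ℂ) * expFun l x
        = 2⁻¹ * (g x * expFun l x + (starRingEnd ℂ) (g x) * expFun l x) := fun x => by
      rw [← add_mul, Complex.add_conj]
      push_cast
      ring
    simp only [h3]
    rw [integral_const_mul, integral_add (hmul l) (hmul2 l), h1, h2, add_zero, mul_zero]
  have him : (fun x => (g x).im) =ᵐ[μ] 0 := by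
    refine ae_eq_zero_of_integral_mul_expFun hg.im fun l => ?_
    have h3 : ∀ x, ((g x).im : ℂ) * expFun l x
        = (2 * Complex.I)⁻¹ * (g x * expFun l x - (starRingEnd ℂ) (g x) * expFun l x) := fun x => by
      rw [← sub_mul, Complex.sub_conj]
      have := Complex.I_ne_zero
      push_cast
      field_simp
    simp only [h3]
    rw [integral_const_mul, integral_sub (hmul l) (hmul2 l), h1, h2, sub_zero, mul_zero]
  rw [Lp.eq_zero_iff_ae_eq_zero]
  filter_upwards [hre, him] with x hx hy
  exact Complex.ext hx hy

theorem norm_expLp (μ : Measure ℝ) [IsProbabilityMeasure μ] (l : ℝ) : ‖expLp μ l‖ = 1 := by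
  have h : inner ℂ (expLp μ l) (expLp μ l) = (1 : ℂ) := by
    rw [inner_expLp_expLp, sub_self]
    simp [expFun]
  have h2 : ‖expLp μ l‖ ^ 2 = 1 := by
    rw [norm_sq_eq_re_inner (𝕜 := ℂ), h, RCLike.one_re]
  exact (pow_eq_one_iff_of_nonneg (norm_nonneg _) two_ne_zero).1 h2

theorem orthonormal_expLp {μ : Measure ℝ} [IsProbabilityMeasure μ] {ι : Type*} {f : ι → ℝ}
    (h : ∀ i j, i ≠ j → ∫ x, expFun (f j - f i) x ∂μ = 0) :
    Orthonormal ℂ fun i => expLp μ (f i) :=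
  ⟨fun i => norm_expLp μ (f i), fun i j hij => (inner_expLp_expLp μ _ _).trans (h i j hij)⟩

/-- Parseval for e up to every ε puts e in the closed span of the `v i`. Concretely, e may be
replaced by its residual r, and ‖r‖² ≤ ε. -/
theorem inner_eq_zero_of_sum_inner_sq {E ι : Type*} [NormedAddCommGroup E] [InnerProductSpace ℂ E]
    {v : ι → E} (hv : Orthonormal ℂ v) {e g : E} (hg : ∀ i, inner ℂ (v i) g = 0)
    (he : ∀ ε > 0, ∃ s : Finset ι, ‖e‖ ^ 2 ≤ ∑ i ∈ s, ‖inner ℂ (v i) e‖ ^ 2 + ε) :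
    inner ℂ e g = 0 := by
  have key : ∀ ε > 0, ‖inner ℂ e g‖ ^ 2 ≤ ε * ‖g‖ ^ 2 := fun ε hε => by
    obtain ⟨s, hs⟩ := he ε hε
    set r := e - ∑ i ∈ s, inner ℂ (v i) e • v i with hr
    have h1 : inner ℂ e g = inner ℂ r g := by
      rw [hr, inner_sub_left, sum_inner, Finset.sum_eq_zero, sub_zero]
      intro i _
      rw [inner_smul_left, hg, mul_zero]
    have h2 : ‖r‖ ^ 2 = ‖e‖ ^ 2 - ∑ i ∈ s, ‖inner ℂ (v i) e‖ ^ 2 := by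
      have horth : inner ℂ r (∑ i ∈ s, inner ℂ (v i) e • v i) = 0 := by
        rw [inner_sum]
        refine Finset.sum_eq_zero fun i hi => ?_
        rw [inner_smul_right, hr, inner_sub_left, hv.inner_left_sum _ hi, inner_conj_symm, sub_self,
          mul_zero]
      have hpyth := norm_add_sq_eq_norm_sq_add_norm_sq_of_inner_eq_zero r _ horth
      have hsum : ‖∑ i ∈ s, inner ℂ (v i) e • v i‖ * ‖∑ i ∈ s, inner ℂ (v i) e • v i‖
          = ∑ i ∈ s, ‖inner ℂ (v i) e‖ ^ 2 := by
        rw [← sq]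
        have h3 := hv.inner_sum (fun i => inner ℂ (v i) e) (fun i => inner ℂ (v i) e) s
        have h4 : ∀ z : ℂ, (starRingEnd ℂ) z * z = ((‖z‖ ^ 2 : ℝ) : ℂ) := fun z => by
          rw [Complex.conj_mul', Complex.ofReal_pow]
        simp only [h4] at h3
        rw [norm_sq_eq_re_inner (𝕜 := ℂ), h3, ← Complex.ofReal_sum]
        exact Complex.ofReal_re _
      rw [hr, sub_add_cancel, hsum, ← hr] at hpyth
      nlinarith
    rw [h1]
    calc ‖inner ℂ r g‖ ^ 2 ≤ (‖r‖ * ‖g‖) ^ 2 := by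
          gcongr
          exact norm_inner_le_norm _ _
      _ = ‖r‖ ^ 2 * ‖g‖ ^ 2 := mul_pow _ _ _
      _ ≤ ε * ‖g‖ ^ 2 := by
          gcongr
          linarith
  have hle : ‖inner ℂ e g‖ ^ 2 ≤ 0 := by
    refine le_of_forall_pos_le_add fun δ hδ => ?_
    have h := key (δ / (‖g‖ ^ 2 + 1)) (by positivity)
    refine h.trans ?_
    rw [zero_add, div_mul_eq_mul_div, div_le_iff₀ (by positivity)]
    nlinarith [sq_nonneg ‖g‖]
  have := sq_eq_zero_iff.1 (le_antisymm hle (sq_nonneg _))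
  exact norm_eq_zero.1 this

/-! ### Bessel and Parseval for μ₄ -/

theorem cantorPower_neg (t : ℝ) : cantorPower (-t) = cantorPower t := by
  unfold cantorPower cantorFourier
  simp only [← conj_expFun]
  rw [integral_conj, RCLike.norm_conj]

theorem norm_inner_expLp_sq (l m : ℝ) :
    ‖inner ℂ (expLp cantorMeasure4 l) (expLp cantorMeasure4 m)‖ ^ 2 = cantorPower (m - l) := by
  rw [inner_expLp_expLp, cantorPower, cantorFourier]

theorem integral_expFun_eq_zero {z : ℤ} (hz : CantorZero z) :
    ∫ x, expFun z x ∂cantorMeasure4 = 0 := by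
  have := (cantorPower_eq_zero_iff z).2 ⟨z, hz, rfl⟩
  rw [cantorPower, sq_eq_zero_iff, norm_eq_zero] at this
  exact this

theorem orthonormal_expLp_digitSum {b : ℕ → ℤ} (hb : ∀ k, Odd (b k)) :
    Orthonormal ℂ fun S => expLp cantorMeasure4 (digitSum b S) :=
  orthonormal_expLp fun S T hST => by
    have := integral_expFun_eq_zero (cantorZero_digitSum_sub hb hST.symm)
    push_cast at this
    exact this

/-- Bessel's inequality for the exponential of frequency -ξ. -/
theorem sum_cantorPower_digitSum_le {b : ℕ → ℤ} (hb : ∀ k, Odd (b k)) (ξ : ℝ)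
    (s : Finset (Finset ℕ)) : ∑ S ∈ s, cantorPower (ξ + digitSum b S) ≤ 1 := by
  have h := (orthonormal_expLp_digitSum hb).sum_inner_products_le (expLp cantorMeasure4 (-ξ))
    (s := s)
  simp only [norm_inner_expLp_sq, norm_expLp, one_pow] at h
  refine le_of_eq_of_le (Finset.sum_congr rfl fun S _ => ?_) h
  rw [← cantorPower_neg]
  congr 1
  ring

theorem isSpectrum_range_digitSum {b : ℕ → ℤ} (hb : ∀ k, Odd (b k))
    (h : ∀ ξ : ℝ, ∀ ε > 0, ∃ s : Finset (Finset ℕ),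
      1 ≤ ∑ S ∈ s, cantorPower (ξ + digitSum b S) + ε) :
    IsSpectrum cantorMeasure4 (Set.range fun S => (digitSum b S : ℝ)) := by
  set Λ : Set ℝ := Set.range fun S => (digitSum b S : ℝ)
  have horth : Orthonormal ℂ fun l : Λ => expLp cantorMeasure4 l := by
    refine orthonormal_expLp fun l m hlm => ?_
    obtain ⟨_, S, rfl⟩ := l
    obtain ⟨_, T, rfl⟩ := m
    have hne : T ≠ S := fun hTS => hlm (by rw [hTS])
    have := integral_expFun_eq_zero (cantorZero_digitSum_sub hb hne)
    push_cast at this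
    exact this
  have hbot : (Submodule.span ℂ (Set.range fun l : Λ => expLp cantorMeasure4 l))ᗮ = ⊥ := by
    refine (Submodule.eq_bot_iff _).2 fun g hg => eq_zero_of_inner_expLp fun ξ => ?_
    rw [Submodule.mem_orthogonal] at hg
    refine inner_eq_zero_of_sum_inner_sq (orthonormal_expLp_digitSum hb)
      (fun S => hg _ (Submodule.subset_span ⟨⟨_, S, rfl⟩, rfl⟩)) fun ε hε => ?_
    obtain ⟨s, hs⟩ := h (-ξ) ε hε
    refine ⟨s, ?_⟩
    rw [norm_expLp, one_pow]
    refine hs.trans_eq ?_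
    congr 1
    refine Finset.sum_congr rfl fun S _ => ?_
    rw [norm_inner_expLp_sq, ← cantorPower_neg]
    congr 1
    ring
  refine ⟨?_, HilbertBasis.mkOfOrthogonalEqBot horth hbot, fun l => ?_⟩
  · have hsub : Λ ⊆ Set.range ((↑) : ℤ → ℝ) := by
      rintro _ ⟨S, rfl⟩
      exact ⟨_, rfl⟩
    exact DiscreteTopology.of_subset
      Int.isClosedEmbedding_coe_real.isEmbedding.toHomeomorph.discreteTopology hsub
  · rw [HilbertBasis.coe_mkOfOrthogonalEqBot]
    exact coeFn_expLp _ _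

/-! ### Digit estimates and Parseval's identity from long runs -/

theorem three_mul_sum_range_four_pow (n : ℕ) :
    3 * ∑ k ∈ Finset.range n, (4 : ℤ) ^ k = 4 ^ n - 1 := by
  induction n with
  | zero => simp
  | succ n ih => rw [Finset.sum_range_succ, mul_add, ih]; ring

theorem three_mul_digitSum_le {s : ℕ → ℤ} (hs : ∀ k, s k ≤ 1) {n : ℕ} {S : Finset ℕ}
    (hS : S ⊆ Finset.range n) : 3 * digitSum s S ≤ 4 ^ n := by
  have h1 : digitSum s S ≤ ∑ k ∈ S, (4 : ℤ) ^ k :=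
    Finset.sum_le_sum fun k _ => mul_le_of_le_one_right (by positivity) (hs k)
  have h2 : ∑ k ∈ S, (4 : ℤ) ^ k ≤ ∑ k ∈ Finset.range n, (4 : ℤ) ^ k :=
    Finset.sum_le_sum_of_subset_of_nonneg hS fun _ _ _ => by positivity
  have := three_mul_sum_range_four_pow n
  omega

theorem neg_four_pow_le_three_mul_digitSum {s : ℕ → ℤ} (hs : ∀ k, -1 ≤ s k) {n : ℕ} {S : Finset ℕ}
    (hpos : ∀ k ∈ S, n ≤ k → 0 ≤ s k) : -4 ^ n ≤ 3 * digitSum s S := by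
  have h1 : ∑ k ∈ S, -(if k < n then (4 : ℤ) ^ k else 0) ≤ digitSum s S := by
    refine Finset.sum_le_sum fun k hk => ?_
    have h4 : (0 : ℤ) < 4 ^ k := by positivity
    split_ifs with hkn
    · nlinarith [hs k]
    · rw [neg_zero]
      exact mul_nonneg h4.le (hpos k hk (not_lt.1 hkn))
  have h2 : ∑ k ∈ S with k < n, (4 : ℤ) ^ k ≤ ∑ k ∈ Finset.range n, (4 : ℤ) ^ k :=
    Finset.sum_le_sum_of_subset_of_nonneg
      (fun k hk => Finset.mem_range.2 (Finset.mem_filter.1 hk).2) fun _ _ _ => by positivity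
  rw [Finset.sum_neg_distrib, ← Finset.sum_filter] at h1
  have := three_mul_sum_range_four_pow n
  omega

theorem digitSum_union_shiftRight {b : ℕ → ℤ} {p : ℤ} {n m : ℕ} {S T : Finset ℕ}
    (hS : S ⊆ Finset.range n) (hT : T ⊆ Finset.range m)
    (hb : ∀ k, n ≤ k → k < n + m → b k = -p) :
    digitSum b (S ∪ shiftRight n T) = digitSum b S + 4 ^ n * (-p * fourSum T) := by
  have hdisj : Disjoint S (shiftRight n T) := by
    rw [Finset.disjoint_left]
    intro k hk hk'
    obtain ⟨i, -, rfl⟩ := mem_shiftRight.1 hk'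
    have := Finset.mem_range.1 (hS hk)
    omega
  rw [digitSum, Finset.sum_union hdisj, ← digitSum, shiftRight, Finset.sum_map, fourSum,
    Finset.mul_sum, Finset.mul_sum]
  congr 1
  refine Finset.sum_congr rfl fun k hk => ?_
  have := Finset.mem_range.1 (hT hk)
  rw [addRightEmbedding_apply, hb _ (by omega) (by omega), pow_add]
  ring

/-- Recovers S from its extension, so that distinct S have distinct extensions. -/
theorem filter_lt_union_shiftRight {n : ℕ} {S T : Finset ℕ} (hS : S ⊆ Finset.range n) :
    {k ∈ S ∪ shiftRight n T | k < n} = S := by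
  ext k
  simp only [Finset.mem_filter, Finset.mem_union, mem_shiftRight]
  constructor
  · rintro ⟨h | ⟨i, -, rfl⟩, hk⟩
    · exact h
    · omega
  · exact fun h => ⟨Or.inl h, Finset.mem_range.1 (hS h)⟩

/-- If a word in the letters `1` and `-1` contains arbitrarily long runs of `1` that are followed by
equally long runs of `-1`, then, for odd `p > 0`, the frequencies with digits `p` times the letters
satisfy Parseval's identity for all exponentials. -/
theorem exists_one_le_sum_cantorPower {p : ℤ} (hp : Odd p) (hp0 : 0 < p) {s : ℕ → ℤ}
    (hs : ∀ k, s k = 1 ∨ s k = -1)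
    (hrun : ∀ L, ∃ n ≥ L, (∀ k < n, n ≤ k + L → s k = 1) ∧ ∀ k, n ≤ k → k < n + L → s k = -1)
    (ξ : ℝ) {ε : ℝ} (hε : 0 < ε) :
    ∃ t : Finset (Finset ℕ), 1 ≤ ∑ S ∈ t, cantorPower (ξ + digitSum (fun k => p * s k) S) + ε := by
  set b : ℕ → ℤ := fun k => p * s k with hbdef
  have hb : ∀ k, Odd (b k) := fun k => hp.mul (by rcases hs k with h | h <;> rw [h] <;> decide)
  have hdig : ∀ S, digitSum b S = p * digitSum s S := fun S => by
    rw [digitSum, digitSum, Finset.mul_sum]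
    exact Finset.sum_congr rfl fun k _ => by rw [hbdef]; ring
  set F : Finset ℕ → ℝ := fun S => cantorPower (ξ + digitSum b S) with hF
  have hF0 : ∀ S, 0 ≤ F S := fun S => cantorPower_nonneg _
  have hsum : Summable F := summable_of_sum_le hF0 (sum_cantorPower_digitSum_le hb ξ)
  obtain ⟨c, δ, m, hc, hδ, hlow⟩ := exists_cantorPower_ge hp hp0
  -- The factor c is lost when `cosProd` is compared with F, leaving ε/2.
  obtain ⟨u, hu⟩ := summable_iff_vanishing_norm.1 hsum (c * (ε / 2)) (by positivity)
  obtain ⟨N, hN⟩ := (u.sup id).exists_nat_subset_range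
  have htend : Filter.Tendsto
      (fun n => ∑ S ∈ (Finset.range N).powerset, cosProd n (ξ + digitSum b S)) Filter.atTop
      (nhds (∑ S ∈ (Finset.range N).powerset, F S)) :=
    tendsto_finsetSum _ fun S _ => tendsto_cosProd _
  obtain ⟨N₁, hN₁⟩ := Filter.eventually_atTop.1
    (htend.eventually_lt_const (lt_add_of_pos_right _ (half_pos hε)))
  obtain ⟨N₂, hN₂⟩ := Filter.eventually_atTop.1
    ((tendsto_div_four_pow |ξ|).eventually_lt_const (half_pos hδ))
  obtain ⟨N₃, hN₃⟩ := Filter.eventually_atTop.1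
    ((tendsto_div_four_pow (p / 3)).eventually_lt_const (half_pos hδ))
  -- The run after n must hold T, which needs m ≤ L; the run before n must make p/(3·4^L) small; n ≥
  -- L serves the other thresholds.
  obtain ⟨L, hL⟩ : ∃ L, L = N + m + N₁ + N₂ + N₃ := ⟨_, rfl⟩
  obtain ⟨n, hnL, hone, hneg⟩ := hrun L
  have hp0' : (0 : ℝ) < p := by exact_mod_cast hp0
  have h4n : (0 : ℝ) < 4 ^ n := by positivity
  have hξ : |ξ| / 4 ^ n < δ / 2 := hN₂ n (by omega)
  have hξ' : |ξ / 4 ^ n| < δ / 2 := by rwa [abs_div, abs_of_pos h4n]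
  have hext : ∀ S, ∃ T, S ⊆ Finset.range n →
      c * cosProd n (ξ + digitSum b S) ≤ F (S ∪ shiftRight n T) := fun S => by
    by_cases hS : S ⊆ Finset.range n
    · have hup : (3 * digitSum s S : ℝ) ≤ 4 ^ n := by
        exact_mod_cast three_mul_digitSum_le (fun k => by rcases hs k with h | h <;> omega) hS
      have hdown : (-4 ^ (n - L) : ℝ) ≤ 3 * digitSum s S := by
        exact_mod_cast neg_four_pow_le_three_mul_digitSum
          (fun k => by rcases hs k with h | h <;> omega)
          (fun k hk hnk => by
            rw [hone k (Finset.mem_range.1 (hS hk)) (by omega)]; exact zero_le_one)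
      -- The last quotient lies in [-4^(-L), 1], which places x within δ of [0, p/3].
      have hx : (ξ + digitSum b S) / 4 ^ n = ξ / 4 ^ n + p / 3 * (3 * digitSum s S / 4 ^ n) := by
        rw [hdig]
        push_cast
        field_simp
      have hup' : (3 * digitSum s S / 4 ^ n : ℝ) ≤ 1 := (div_le_one h4n).2 hup
      have hdown' : (-(1 / 4 ^ L) : ℝ) ≤ 3 * digitSum s S / 4 ^ n := by
        rw [le_div_iff₀ h4n]
        refine le_of_eq_of_le ?_ hdown
        rw [show (4 : ℝ) ^ n = 4 ^ (n - L) * 4 ^ L by rw [← pow_add, Nat.sub_add_cancel hnL]]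
        field_simp
      have hpL : (p : ℝ) / 3 / 4 ^ L < δ / 2 := hN₃ L (by omega)
      have hp3 : (0 : ℝ) < p / 3 := by positivity
      obtain ⟨T, hT, hcT⟩ := hlow ((ξ + digitSum b S) / 4 ^ n)
        (by
          have := mul_le_mul_of_nonneg_left hdown' hp3.le
          rw [mul_neg, mul_one_div] at this
          rw [hx]
          linarith [neg_abs_le (ξ / 4 ^ n)])
        (by
          have := mul_le_mul_of_nonneg_left hup' hp3.le
          rw [hx]
          linarith [le_abs_self (ξ / 4 ^ n)])
      refine ⟨T, fun _ => ?_⟩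
      have hd : ξ + (digitSum b (S ∪ shiftRight n T) : ℤ)
          = ξ + digitSum b S + 4 ^ n * (-p * fourSum T : ℤ) := by
        rw [digitSum_union_shiftRight (p := p) hS hT fun k h1 h2 => by
          simp only [hbdef]
          rw [hneg k h1 (by omega)]
          ring]
        push_cast
        ring
      simp only [hF]
      rw [hd, cantorPower_eq_cosProd_mul n, cosProd_add_four_pow_mul, mul_comm]
      refine mul_le_mul_of_nonneg_left ?_ (cosProd_nonneg _ _)
      rwa [add_div _ (4 ^ n * _), mul_div_cancel_left₀ _ h4n.ne', Int.cast_mul, Int.cast_neg,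
        neg_mul, ← sub_eq_add_neg]
    · exact ⟨∅, fun h => absurd h hS⟩
  choose T hT using hext
  have hsubset : (Finset.range N).powerset ⊆ (Finset.range n).powerset :=
    Finset.powerset_mono.2 (Finset.range_mono (by omega))
  -- Extensions of sets not inside `range N` are not in u, so their terms belong to the small tail
  -- of F.
  have htail : ∑ S ∈ (Finset.range n).powerset \ (Finset.range N).powerset,
      cosProd n (ξ + digitSum b S) ≤ ε / 2 := by
    have hmem : ∀ S ∈ (Finset.range n).powerset \ (Finset.range N).powerset,
        S ⊆ Finset.range n ∧ ¬ S ⊆ Finset.range N := fun S hS => by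
      simpa only [Finset.mem_sdiff, Finset.mem_powerset] using hS
    have h1 : c * ∑ S ∈ (Finset.range n).powerset \ (Finset.range N).powerset,
        cosProd n (ξ + digitSum b S) ≤
        ∑ S ∈ ((Finset.range n).powerset \ (Finset.range N).powerset).image
          (fun S => S ∪ shiftRight n (T S)), F S := by
      rw [Finset.mul_sum, Finset.sum_image]
      · exact Finset.sum_le_sum fun S hS => hT S (hmem S hS).1
      · intro S hS S' hS' h
        rw [← filter_lt_union_shiftRight (T := T S) (hmem S hS).1,
          ← filter_lt_union_shiftRight (T := T S') (hmem S' hS').1]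
        simp only at h
        rw [h]
    have h2 := hu (((Finset.range n).powerset \ (Finset.range N).powerset).image
      (fun S => S ∪ shiftRight n (T S))) (by
        rw [Finset.disjoint_left]
        intro V hV hVu
        obtain ⟨S, hS, rfl⟩ := Finset.mem_image.1 hV
        exact (hmem S hS).2 (Finset.subset_union_left.trans
          ((Finset.le_sup (f := id) hVu).trans hN)))
    rw [Real.norm_of_nonneg (Finset.sum_nonneg fun S _ => hF0 S)] at h2
    exact le_of_mul_le_mul_left (h1.trans h2.le) hc
  refine ⟨(Finset.range N).powerset, ?_⟩
  have htotal := sum_cosProd_digitSum hb ξ n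
  rw [← Finset.sum_sdiff hsubset] at htotal
  have := hN₁ n (by omega)
  linarith

/-! ### The label A₁ and its runs -/

theorem smul_labelSet_eq (p : ℤ) (a : ℕ → ℤ) :
    (p : ℝ) • labelSet a = Set.range fun S => (digitSum (fun k => p * a (k + 1)) S : ℝ) := by
  have hshift : ∀ (n : ℕ) (f : ℕ → ℝ),
      ∑ k ∈ Finset.Icc 1 n, f k = ∑ k ∈ Finset.range n, f (k + 1) := fun n f => by
    rw [Finset.range_eq_Ico, Finset.sum_Ico_add' f 0 n 1, zero_add]
    rfl
  ext x
  simp only [Set.mem_smul_set, smul_eq_mul, Set.mem_range, labelSet, Set.mem_ofPred_eq]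
  constructor
  · rintro ⟨_, ⟨n, -, w, hw, rfl⟩, rfl⟩
    refine ⟨{k ∈ Finset.range n | w (k + 1) ≠ 0}, ?_⟩
    rw [hshift, digitSum, Finset.sum_filter, Int.cast_sum, Finset.mul_sum]
    refine Finset.sum_congr rfl fun k _ => ?_
    rw [Nat.add_sub_cancel]
    split_ifs with h
    · rw [(hw (k + 1)).resolve_left h]
      push_cast
      ring
    · rw [not_not.1 h]
      simp
  · rintro ⟨S, rfl⟩
    obtain ⟨n, hn⟩ := S.exists_nat_subset_range
    -- Letter k sits at place k - 1. The truncated value at k = 0 does not enter the sum, and n + 1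
    -- ensures a positive length.
    refine ⟨_, ⟨n + 1, by omega, fun k => if k - 1 ∈ S then a k else 0, fun k => ?_, rfl⟩, ?_⟩
    · by_cases h : k - 1 ∈ S <;> simp [h]
    · rw [hshift, digitSum, Int.cast_sum, Finset.mul_sum,
        ← Finset.sum_subset (hn.trans (Finset.range_mono n.le_succ))]
      · refine Finset.sum_congr rfl fun k hk => ?_
        simp only [Nat.add_sub_cancel, if_pos hk]
        push_cast
        ring
      · intro k _ hk
        simp [hk]

theorem labelA1_eq_one_or (k : ℕ) : labelA1 k = 1 ∨ labelA1 k = -1 := by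
  unfold labelA1
  split_ifs <;> simp

theorem labelA1_sq_add_of_lt {N i : ℕ} (hi : i < N) : labelA1 (N ^ 2 + i) = 1 := by
  have : Nat.sqrt (N ^ 2 + i) = N := by
    rw [pow_two]
    exact Nat.sqrt_add_eq _ (by omega)
  rw [labelA1, this, if_pos (by omega)]

theorem labelA1_sq_add_of_le {N i : ℕ} (hi : N ≤ i) (hi' : i ≤ 2 * N) :
    labelA1 (N ^ 2 + i) = -1 := by
  have : Nat.sqrt (N ^ 2 + i) = N := by
    rw [pow_two]
    exact Nat.sqrt_add_eq _ (by omega)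
  rw [labelA1, this, if_neg (by omega)]

theorem isSpectrum_smul_labelA1 {p : ℤ} (hp : Odd p) :
    IsSpectrum cantorMeasure4 ((p : ℝ) • labelSet labelA1) := by
  rw [smul_labelSet_eq]
  have hodd : ∀ k, Odd (labelA1 k) := fun k => by
    rcases labelA1_eq_one_or k with h | h <;> rw [h] <;> decide
  refine isSpectrum_range_digitSum (fun k => hp.mul (hodd _)) fun ξ ε hε => ?_
  have hp0 : p ≠ 0 := by rintro rfl; simp at hp
  rcases hp0.lt_or_gt with hneg | hpos
  · obtain ⟨t, ht⟩ := exists_one_le_sum_cantorPower (p := -p) (s := fun k => -labelA1 (k + 1))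
      hp.neg (by omega) (fun k => by rcases labelA1_eq_one_or (k + 1) with h | h <;> simp [h])
      (fun L => by
        -- Place k carries letter k + 1, so this is the place where τ_{L+1} begins, after the
        -- letters -1 of τ_L.
        refine ⟨L ^ 2 + 2 * L, by nlinarith, fun k hk hkL => ?_, fun k hk hkL => ?_⟩
        · obtain ⟨i, hi⟩ := Nat.exists_eq_add_of_le (show L ^ 2 ≤ k + 1 by omega)
          rw [hi, labelA1_sq_add_of_le (by omega) (by omega), neg_neg]
        · have hsq : (L + 1) ^ 2 = L ^ 2 + 2 * L + 1 := by ring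
          obtain ⟨i, hi⟩ := Nat.exists_eq_add_of_le (show (L + 1) ^ 2 ≤ k + 1 by omega)
          rw [hi, labelA1_sq_add_of_lt (by omega)]) ξ hε
    simp only [neg_mul_neg] at ht
    exact ⟨t, ht⟩
  · exact exists_one_le_sum_cantorPower hp hpos (s := fun k => labelA1 (k + 1))
      (fun k => labelA1_eq_one_or _) (fun L => by
        have hsq : (L + 1) ^ 2 = L ^ 2 + 2 * L + 1 := by ring
        -- The place of the first -1 in τ_{L+1}.
        refine ⟨(L + 1) ^ 2 + L, by nlinarith, fun k hk hkL => ?_, fun k hk hkL => ?_⟩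
        · obtain ⟨i, hi⟩ := Nat.exists_eq_add_of_le (show (L + 1) ^ 2 ≤ k + 1 by omega)
          rw [hi, labelA1_sq_add_of_lt (by omega)]
        · obtain ⟨i, hi⟩ := Nat.exists_eq_add_of_le (show (L + 1) ^ 2 ≤ k + 1 by omega)
          rw [hi, labelA1_sq_add_of_le (by omega) (by omega)]) ξ hε

theorem theorem4p6 :
    IsSpectrum cantorMeasure4 (labelSet labelA1) ∧
      ∀ p : ℤ, Odd p → IsSpectrum cantorMeasure4 ((p : ℝ) • labelSet labelA1) :=
  ⟨by simpa using isSpectrum_smul_labelA1 odd_one, fun _ => isSpectrum_smul_labelA1⟩
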